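/- Let $G$ be a compact (Hausdorff) Lie group with normalised Haar measure $\mu_G$, and let $\widehat G$ be the set of equivalence classes of continuous irreducible unitary representations $\pi:G\to U(d_\pi)$, $d_\pi\ge 1$. For $f\in L^1(G)$ put $\hat f(\pi)=\int_G f(g)\pi(g)^*\,d\mu_G(g)$. Let $X$ be a Hausdorff space with a continuous transitive action of $G$, fix $x_0\in X$ with stabiliser $H$ and normalised Haar measure $\mu_H$ on $H$, write $\tilde\phi(g)=\phi(g\cdot x_0)$ for functions $\phi$ on $X$, put $\hat\phi:=\hat{\tilde\phi}$, and let $dx$ be the invariant measure with $\int_X\phi\,dx=\int_G\tilde\phi\,d\mu_G$. For $\phi,\psi\in L^2(X)$ let $$\phi\bullet\psi(g)=\int_X\phi(x)\overline{\psi(g^{-1}\cdot x)}\,dx\quad(g\in G),\qquad \phi\,\hat\bullet\,\psi(x)=\int_G\overline{\phi(g\cdot x_0)}\,\psi(g\cdot x)\,d\mu_G(g)\quad(x\in X).$$ Let $\widehat G_+\subset\widehat G$ be co-finite. Let $t\mapsto p_t$ be a diffusive approximate identity with respect to $\widehat G_+$, i.e. a family in $C^1((0,\infty);L^1(G))$ such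 that (1) the spectral norms $\|\hat p_t(\pi)\|$ are bounded uniformly in $\pi\in\widehat G$, $t>0$; (2) $\lim_{t\to0}\hat p_t(\pi)=I$ for all $\pi\in\widehat G$; (3) $\lim_{t\to\infty}\hat p_t(\pi)=0$ for $\pi\in\widehat G_+$; (4) $-\partial_t\hat p_t(\pi)$ is positive semidefinite for all $t>0$, $\pi\in\widehat G_+$. Let $p_t^X(g\cdot x_0)=\int_H\int_H p_t(h_1gh_2)\,d\mu_H(h_1)\,d\mu_H(h_2)$. Let $L^2_0(G)$ be the closed linear span in $L^2(G)$ of the spaces $\mathcal H_\pi=\{g\mapsto\operatorname{tr}(\pi(g)A):A\in\mathbb C^{d_\pi\times d_\pi}\}$, $\pi\in\widehat G_+$, and $L^2_0(X)=\{\phi\in L^2(X):\tilde\phi\in L^2_0(G)\}$. Let $\alpha\ge0$ be a measurable weight on $\mathbb R_+=(0,\infty)$ and let $\psi_\rho\in L^2(X)$, $\rho>0$, be a (non-zonal) diffusive wavelet family: a family measurable in $\rho$ with $$p_t^X\big|_{\widehat G_+}=\int_t^\infty \psi_\rho\,\hat\bullet\,\psi_\rho\;\alpha(\rho)\,d\rho\qquad\text{for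 all }t>0,$$ where $\cdot|_{\widehat G_+}$ keeps the Fourier coefficients at $\pi\in\widehat G_+$ and sets the others to $0$, and the identity is understood in the sense of distributions, i.e. for every $\pi\in\widehat G$ the Fourier coefficients at $\pi$ of $\psi_\rho\,\hat\bullet\,\psi_\rho$, times $\alpha(\rho)$, are integrable over $(t,\infty)$ and their integral is the Fourier coefficient at $\pi$ of the left-hand side. Then the transform $\phi\mapsto\mathcal W\phi$, $\mathcal W\phi(\rho,g)=\phi\bullet\psi_\rho(g)$, is a well-defined linear map from $L^2_0(X)$ to $L^2(\mathbb R_+\times G,\ \alpha(\rho)\,d\rho\otimes d\mu_G)$ that preserves inner products, and it is unitary from $L^2_0(X)$ onto its range, which is a closed subspace. -/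

import Mathlib

open MeasureTheory Filter Topology Set
open scoped ContDiff Matrix ComplexOrder

namespace DiffusiveWavelet

noncomputable section

/-! ### Irreducible unitary representations, the unitary dual and Fourier coefficients -/

/-- A continuous irreducible unitary representation `G → U(d)`, `d ≥ 1`; irreducibility means that
only the scalar matrices commute with all `π g`. -/
structure UnitaryIrrep (G : Type*) [Group G] [TopologicalSpace G] where
  /-- the dimension of the representation -/
  dim : ℕ
  dim_pos : 0 < dim
  /-- the homomorphism into the unitary group -/
  hom : G →* Matrix.unitaryGroup (Fin dim) ℂ
  continuous_hom : Continuous hom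
  irreducible : ∀ A : Matrix (Fin dim) (Fin dim) ℂ,
    (∀ g : G, (hom g : Matrix (Fin dim) (Fin dim) ℂ) * A = A * (hom g)) →
      ∃ c : ℂ, A = c • (1 : Matrix (Fin dim) (Fin dim) ℂ)

section Dual

variable {G : Type*} [Group G] [TopologicalSpace G]

/-- The matrix `π(g)`. -/
def UnitaryIrrep.mat (π : UnitaryIrrep G) (g : G) : Matrix (Fin π.dim) (Fin π.dim) ℂ := π.hom g

/-- Equivalence of representations: `π(g) A = A σ(g)` for all `g` and some invertible `A`. -/
def UnitaryIrrep.Equivalent (π σ : UnitaryIrrep G) : Prop :=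
  ∃ (A : Matrix (Fin π.dim) (Fin σ.dim) ℂ) (B : Matrix (Fin σ.dim) (Fin π.dim) ℂ),
    A * B = 1 ∧ B * A = 1 ∧ ∀ g : G, π.mat g * A = A * σ.mat g

variable (G) in
/-- Equivalence of irreducible representations as a setoid. -/
def irrepSetoid : Setoid (UnitaryIrrep G) where
  r := UnitaryIrrep.Equivalent
  iseqv :=
    { refl := fun π => ⟨1, 1, by simp, by simp, by simp⟩
      symm := by
        rintro π σ ⟨A, B, hAB, hBA, h⟩
        refine ⟨B, A, hBA, hAB, fun g => ?_⟩
        calc σ.mat g * B = (B * A) * (σ.mat g * B) := by rw [hBA, Matrix.one_mul]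
          _ = B * (A * σ.mat g) * B := by simp only [Matrix.mul_assoc]
          _ = B * (π.mat g * A) * B := by rw [h]
          _ = B * π.mat g * (A * B) := by simp only [Matrix.mul_assoc]
          _ = B * π.mat g := by rw [hAB, Matrix.mul_one]
      trans := by
        rintro π σ τ ⟨A, B, hAB, hBA, h⟩ ⟨C, D, hCD, hDC, k⟩
        refine ⟨A * C, D * B, ?_, ?_, fun g => ?_⟩
        · calc A * C * (D * B) = A * (C * D) * B := by simp only [Matrix.mul_assoc]
            _ = 1 := by rw [hCD, Matrix.mul_one, hAB]
        · calc D * B * (A * C) = D * (B * A) * C := by simp only [Matrix.mul_assoc]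
            _ = 1 := by rw [hBA, Matrix.mul_one, hDC]
        · calc π.mat g * (A * C) = (π.mat g * A) * C := by rw [Matrix.mul_assoc]
            _ = A * (σ.mat g * C) := by rw [h, Matrix.mul_assoc]
            _ = A * C * τ.mat g := by rw [k, Matrix.mul_assoc] }

variable (G) in
/-- The unitary dual `Ĝ`: equivalence classes of irreducible unitary representations. -/
def UnitaryDual : Type _ := Quotient (irrepSetoid G)

/-- The class of `π` in the unitary dual. -/
def UnitaryIrrep.cls (π : UnitaryIrrep G) : UnitaryDual G := Quotient.mk (irrepSetoid G) π

variable [MeasurableSpace G]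

/-- The Fourier coefficient `f̂(π) = ∫_G f(g) π(g)^* dμ(g)` (entrywise integral). -/
def fourierCoeff (μ : Measure G) (f : G → ℂ) (π : UnitaryIrrep G) :
    Matrix (Fin π.dim) (Fin π.dim) ℂ :=
  Matrix.of fun i j => ∫ g, f g * ((π.mat g)ᴴ i j) ∂μ

/-- The subspace `H_π = {g ↦ tr(π(g) A)}` of `L²(G)`. -/
def coeffSpace (μ : Measure G) (π : UnitaryIrrep G) : Submodule ℂ (Lp ℂ 2 μ) where
  carrier := {f | ∃ A : Matrix (Fin π.dim) (Fin π.dim) ℂ,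
    (f : G → ℂ) =ᵐ[μ] fun g => (π.mat g * A).trace}
  zero_mem' := ⟨0, by
    filter_upwards [Lp.coeFn_zero ℂ 2 μ] with g hg
    rw [hg]
    simp⟩
  add_mem' := by
    rintro f₁ f₂ ⟨A, hA⟩ ⟨B, hB⟩
    refine ⟨A + B, ?_⟩
    filter_upwards [Lp.coeFn_add f₁ f₂, hA, hB] with g h h₁ h₂
    rw [h, Pi.add_apply, h₁, h₂, Matrix.mul_add, Matrix.trace_add]
  smul_mem' := by
    rintro c f ⟨A, hA⟩
    refine ⟨c • A, ?_⟩
    filter_upwards [Lp.coeFn_smul c f, hA] with g h h₁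
    rw [h, Pi.smul_apply, h₁, Matrix.mul_smul, Matrix.trace_smul]

/-- `L²_0(G) = ⊕_{π ∈ Ĝ₊} H_π`, the closed linear span in `L²(G)`. -/
def L2ZeroGroup (μ : Measure G) (Gplus : Set (UnitaryDual G)) : Submodule ℂ (Lp ℂ 2 μ) :=
  (⨆ π ∈ {π : UnitaryIrrep G | π.cls ∈ Gplus}, coeffSpace μ π).topologicalClosure

/-- Diffusive approximate identities with respect to a co-finite set `Ĝ₊ ⊆ Ĝ`: `C¹` families
`(0, ∞) → L¹(G)` with the four conditions on the Fourier coefficients. The norm in `bounded` is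
the spectral norm; "positive" in `deriv_nonpos` means Hermitian positive semidefinite. -/
structure IsDiffusiveApproximateIdentity (μ : Measure G) (Gplus : Set (UnitaryDual G))
    (p : ℝ → Lp ℂ 1 μ) : Prop where
  cofinite : Gplusᶜ.Finite
  contDiffOn : ContDiffOn ℝ 1 p (Ioi 0)
  bounded : ∃ C : ℝ, ∀ π : UnitaryIrrep G, ∀ t : ℝ, 0 < t →
    ‖Matrix.toEuclideanCLM (n := Fin π.dim) (𝕜 := ℂ) (fourierCoeff μ (p t) π)‖ ≤ C
  tendsto_zero : ∀ π : UnitaryIrrep G,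
    Tendsto (fun t => fourierCoeff μ (p t) π) (𝓝[>] 0) (𝓝 1)
  tendsto_atTop : ∀ π : UnitaryIrrep G, π.cls ∈ Gplus →
    Tendsto (fun t => fourierCoeff μ (p t) π) atTop (𝓝 0)
  deriv_nonpos : ∀ π : UnitaryIrrep G, π.cls ∈ Gplus → ∀ t : ℝ, 0 < t →
    (Matrix.of fun i j => -deriv (fun s => fourierCoeff μ (p s) π i j) t).PosSemidef

end Dual

/-! ### Homogeneous spaces -/

section Homogeneous

variable {G : Type*} [Group G] [TopologicalSpace G] [MeasurableSpace G]
variable {X : Type*} [MulAction G X]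

/-- The lift `f̃(g) = f(g • x₀)` of a function on `X`. -/
def lift (x₀ : X) (f : X → ℂ) (g : G) : ℂ := f (g • x₀)

/-- The invariant measure on `X`: `∫_X f dx = ∫_G f(g • x₀) dμ(g)`. -/
def orbitMeasure [MeasurableSpace X] (μ : Measure G) (x₀ : X) : Measure X :=
  μ.map fun g => g • x₀

/-- The `•`-product `φ • ψ (g) = ∫_X φ(x) conj(ψ(g⁻¹ x)) dx`. -/
def bulletProd [MeasurableSpace X] (ν : Measure X) (φ ψ : X → ℂ) (g : G) : ℂ :=
  ∫ x, φ x * (starRingEnd ℂ) (ψ (g⁻¹ • x)) ∂ν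

/-- The zonal product `φ •̂ ψ (x) = ∫_G conj(φ(g x₀)) ψ(g x) dμ(g)`. -/
def zonalProd (μ : Measure G) (x₀ : X) (φ ψ : X → ℂ) (x : X) : ℂ :=
  ∫ g, (starRingEnd ℂ) (φ (g • x₀)) * ψ (g • x) ∂μ

/-- Fourier coefficients of a function on `X` are those of its lift. -/
def fourierCoeffX (μ : Measure G) (x₀ : X) (f : X → ℂ) (π : UnitaryIrrep G) :
    Matrix (Fin π.dim) (Fin π.dim) ℂ :=
  fourierCoeff μ (lift x₀ f) π

/-- The zonal average of `f : G → ℂ` as a function on `X`: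
`f^X(g • x₀) = ∫_H ∫_H f(h₁ g h₂) dμ_H(h₁) dμ_H(h₂)`, `H` the stabiliser of `x₀`.
See `zonalAverage_smul` for the independence of the choice of `g`. -/
def zonalAverage [MulAction.IsPretransitive G X] (x₀ : X)
    (μH : Measure (MulAction.stabilizer G x₀)) (f : G → ℂ) (x : X) : ℂ :=
  ∫ h₁, ∫ h₂, f (h₁ * (MulAction.exists_smul_eq G x₀ x).choose * h₂) ∂μH ∂μH

theorem zonalAverage_smul [IsTopologicalGroup G] [BorelSpace G] [MulAction.IsPretransitive G X]
    (x₀ : X) (μH : Measure (MulAction.stabilizer G x₀)) [μH.IsMulLeftInvariant]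
    (f : G → ℂ) (g : G) :
    zonalAverage x₀ μH f (g • x₀) = ∫ h₁, ∫ h₂, f (h₁ * g * h₂) ∂μH ∂μH := by
  unfold zonalAverage
  set k := (MulAction.exists_smul_eq G x₀ (g • x₀)).choose with hk
  have hkx : k • x₀ = g • x₀ := (MulAction.exists_smul_eq G x₀ (g • x₀)).choose_spec
  have hs : g⁻¹ * k ∈ MulAction.stabilizer G x₀ := by
    rw [MulAction.mem_stabilizer_iff, mul_smul, hkx, inv_smul_smul]
  congr 1
  funext h₁
  rw [← integral_mul_left_eq_self
    (fun h : MulAction.stabilizer G x₀ => f (h₁ * g * h)) ⟨g⁻¹ * k, hs⟩]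
  congr 1
  funext h₂
  congr 1
  simp [mul_assoc]

variable [TopologicalSpace X] [ContinuousSMul G X] [BorelSpace G] [MeasurableSpace X]
  [BorelSpace X]

/-- The lift `φ ↦ φ̃` as a linear isometry `L²(X) → L²(G)`. -/
def liftL2 (μ : Measure G) (x₀ : X) : Lp ℂ 2 (orbitMeasure μ x₀) →ₗᵢ[ℂ] Lp ℂ 2 μ :=
  Lp.compMeasurePreservingₗᵢ ℂ (fun g : G => g • x₀)
    ⟨(continuous_id.smul continuous_const).measurable, rfl⟩

/-- `L²_0(X)`: the functions in `L²(X)` whose lift belongs to `L²_0(G)`. -/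
def L2Zero (μ : Measure G) (x₀ : X) (Gplus : Set (UnitaryDual G)) :
    Submodule ℂ (Lp ℂ 2 (orbitMeasure μ x₀)) :=
  (L2ZeroGroup μ Gplus).comap (liftL2 μ x₀).toLinearMap

/-- The measure `α(ρ) dρ` on the half-line `(0, ∞)`. -/
def scaleMeasure (α : ℝ → ℝ) : Measure ℝ :=
  (volume.restrict (Ioi 0)).withDensity fun ρ => ENNReal.ofReal (α ρ)

/-- The admissibility condition
`p_t^X |_{Ĝ₊} = ∫_t^∞ (ψ_ρ •̂ ψ_ρ) α(ρ) dρ` for all `t > 0`, as an identity of distributions, i.e.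
between all Fourier coefficients. The projection `f |_{Ĝ₊}` onto the components in `Ĝ₊` keeps the
Fourier coefficients of `f` at `π ∈ Ĝ₊` and replaces those at `π ∉ Ĝ₊` by `0`. The family `ψ` is
required to be measurable in the scale parameter (values at `ρ ≤ 0` are irrelevant). -/
structure IsDiffusiveWaveletFamily [MulAction.IsPretransitive G X] (μ : Measure G) (x₀ : X)
    (μH : Measure (MulAction.stabilizer G x₀)) (Gplus : Set (UnitaryDual G))
    (p : ℝ → Lp ℂ 1 μ) (α : ℝ → ℝ) (ψ : ℝ → Lp ℂ 2 (orbitMeasure μ x₀)) : Prop where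
  measurable : AEStronglyMeasurable ψ (scaleMeasure α)
  integrable : ∀ t : ℝ, 0 < t → ∀ (π : UnitaryIrrep G) (i j : Fin π.dim),
    IntegrableOn
      (fun ρ => fourierCoeffX μ x₀ (zonalProd μ x₀ (ψ ρ) (ψ ρ)) π i j * (α ρ : ℂ)) (Ioi t)
  admissible : ∀ t : ℝ, 0 < t → ∀ π : UnitaryIrrep G, π.cls ∈ Gplus → ∀ i j : Fin π.dim,
    fourierCoeffX μ x₀ (zonalAverage x₀ μH (p t)) π i j =
      ∫ ρ in Ioi t, fourierCoeffX μ x₀ (zonalProd μ x₀ (ψ ρ) (ψ ρ)) π i j * (α ρ : ℂ)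
  admissible_compl : ∀ t : ℝ, 0 < t → ∀ π : UnitaryIrrep G, π.cls ∉ Gplus → ∀ i j : Fin π.dim,
    0 = ∫ ρ in Ioi t, fourierCoeffX μ x₀ (zonalProd μ x₀ (ψ ρ) (ψ ρ)) π i j * (α ρ : ℂ)

/-- The diffusive wavelet transform `W φ(ρ, g) = φ • ψ_ρ (g)`. -/
def waveletTransform (ν : Measure X) (ψ : ℝ → Lp ℂ 2 ν) (φ : Lp ℂ 2 ν) (z : ℝ × G) : ℂ :=
  bulletProd ν φ (ψ z.1) z.2

end Homogeneous

end

end DiffusiveWavelet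

open DiffusiveWavelet

set_option linter.unusedSectionVars false

namespace DiffusiveWavelet

/-! Lift everything to `G`: with `f = φ̃` and `s_ρ = ψ̃_ρ` the transform is the convolution `f *
s_ρ^*`. On a matrix coefficient `f(g) = tr(π(g) A)` it acts by `A ↦ ŝ_ρ(π)^* A` (`convStar_trace`),
so by Schur orthogonality its squared norm in `g` is `d_π⁻¹ tr(A A^* ŝ_ρ ŝ_ρ^*)`. The factor `ŝ_ρ
ŝ_ρ^*` is the Fourier coefficient of the zonal product of `ψ_ρ` with itself
(`fourierCoeffX_zonalProd`), so admissibility turns the weighted integral over `ρ > t` into `d_π⁻¹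
tr(A A^* (p_t^X)^(π))`.

A lift is right `H`-invariant, which at the level of coefficients reads `π(h) A = A` for `h ∈ H`.
Then `A A^*` is invariant on both sides and absorbs the two averages in `p_t^X`
(`trace_mul_fourierCoeffX_zonalAverage`). What remains is `tr(A A^* p̂_t(π))`, which tends to `tr(A
A^*)` as `t → 0`, and `d_π⁻¹ tr(A A^*)` is `‖f‖²`. Orthogonality of inequivalent representations
extends this to finite sums (`lintegral_convStar_sq`).

Lifts of `L²_0(X)` lie in the closure of these sums (`mem_closure_invariantSpan`). Each evaluation
`f ↦ (f * s_ρ^*)(g)` is continuous on `L²(G)`, so the isometry extends to the closure and is still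
given by the same integral (`exists_linearIsometry_topologicalClosure`). A linear isometry preserves
inner products, and on a complete space its range is closed. -/

theorem trace_mul_eq_sum {m n : ℕ} (N : Matrix (Fin n) (Fin m) ℂ) (F : Matrix (Fin m) (Fin n) ℂ) :
    (N * F).trace = ∑ i, ∑ j, N i j * F j i := by
  simp [Matrix.trace, Matrix.mul_apply]

theorem trace_mul_integral {Ω : Type*} [MeasurableSpace Ω] (μ : Measure Ω) {m n : ℕ}
    (N : Matrix (Fin n) (Fin m) ℂ) {F : Ω → Matrix (Fin m) (Fin n) ℂ} (hF : ∀ i j, Integrable (fun g => F g i j) μ) :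
    (N * Matrix.of fun i j => ∫ g, F g i j ∂μ).trace = ∫ g, (N * F g).trace ∂μ := by
  simp only [trace_mul_eq_sum]
  symm
  refine (integral_finsetSum _ fun i _ => integrable_finsetSum _ fun j _ =>
    (hF j i).const_mul (N i j)).trans (Finset.sum_congr rfl fun i _ => ?_)
  refine (integral_finsetSum _ fun j _ => (hF j i).const_mul (N i j)).trans
    (Finset.sum_congr rfl fun j _ => ?_)
  exact integral_const_mul _ _

/-! ### Unitarity of the representation matrices. -/

section Irrep

variable {G : Type*} [Group G] [TopologicalSpace G] (π σ : UnitaryIrrep G)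

theorem UnitaryIrrep.mat_mul (g h : G) : π.mat (g * h) = π.mat g * π.mat h := by
  simp [UnitaryIrrep.mat]

theorem UnitaryIrrep.mat_conjTranspose_mul_mat (g : G) : (π.mat g)ᴴ * π.mat g = 1 := by
  have := Matrix.mem_unitaryGroup_iff'.1 (π.hom g).2
  simpa [UnitaryIrrep.mat, Matrix.star_eq_conjTranspose] using this

theorem UnitaryIrrep.mat_mul_conjTranspose_mat (g : G) : π.mat g * (π.mat g)ᴴ = 1 := by
  have := Matrix.mem_unitaryGroup_iff.1 (π.hom g).2
  simpa [UnitaryIrrep.mat, Matrix.star_eq_conjTranspose] using this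

theorem UnitaryIrrep.mat_inv (g : G) : π.mat g⁻¹ = (π.mat g)ᴴ := by
  have h : π.mat g⁻¹ * π.mat g = 1 := by
    rw [← π.mat_mul]; simp [UnitaryIrrep.mat]
  calc π.mat g⁻¹ = π.mat g⁻¹ * (π.mat g * (π.mat g)ᴴ) := by
        rw [π.mat_mul_conjTranspose_mat, Matrix.mul_one]
    _ = (π.mat g)ᴴ := by rw [← Matrix.mul_assoc, h, Matrix.one_mul]

@[fun_prop]
theorem UnitaryIrrep.continuous_mat : Continuous π.mat :=
  continuous_subtype_val.comp π.continuous_hom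

end Irrep

/-! ### Fourier coefficients on a compact group. -/

section Group

variable {G : Type*} [Group G] [TopologicalSpace G] [IsTopologicalGroup G] [CompactSpace G]
  [SecondCountableTopology G] [MeasurableSpace G] [BorelSpace G]

/-- A right translate of `μ` is again a left Haar probability measure, hence equals `μ` by
uniqueness. -/
theorem isMulRightInvariant_of_isProbabilityMeasure (μ : Measure G) [μ.IsHaarMeasure]
    [IsProbabilityMeasure μ] : μ.IsMulRightInvariant where
  map_mul_right_eq_self g := by
    have : IsProbabilityMeasure (μ.map (· * g)) :=
      Measure.isProbabilityMeasure_map (by fun_prop)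
    exact Measure.isHaarMeasure_eq_of_isProbabilityMeasure _ _

theorem _root_.Continuous.integrable_of_compactSpace {μ : Measure G} [IsFiniteMeasure μ] {u : G → ℂ}
    (hu : Continuous u) : Integrable u μ :=
  hu.integrable_of_hasCompactSupport (HasCompactSupport.of_compactSpace u)

theorem _root_.Continuous.memLp_of_compactSpace {μ : Measure G} [IsFiniteMeasure μ] {u : G → ℂ}
    (hu : Continuous u) : MemLp u 2 μ :=
  hu.memLp_of_hasCompactSupport (HasCompactSupport.of_compactSpace u)

theorem _root_.MeasureTheory.Integrable.mul_continuous {μ : Measure G} {f u : G → ℂ}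
    (hf : Integrable f μ) (hu : Continuous u) : Integrable (fun g => f g * u g) μ := by
  obtain ⟨C, hC⟩ := (isCompact_range hu).isBounded.exists_norm_le
  exact hf.mul_bdd (c := C) hu.aestronglyMeasurable (.of_forall fun g => hC _ ⟨g, rfl⟩)

variable (μ : Measure G)

/-- A matrix is determined by its traces against all `M`; in this form identities between Fourier
coefficients become identities of scalar integrals, where translation and Fubini apply. -/
theorem trace_mul_fourierCoeff {f : G → ℂ} (hf : Integrable f μ) (π : UnitaryIrrep G)
    (M : Matrix (Fin π.dim) (Fin π.dim) ℂ) :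
    (M * fourierCoeff μ f π).trace = ∫ g, f g * (M * (π.mat g)ᴴ).trace ∂μ := by
  have hint : ∀ i j, Integrable (fun g => (f g • (π.mat g)ᴴ) i j) μ := fun i j =>
    hf.mul_continuous (u := fun g => (π.mat g)ᴴ i j) (by fun_prop)
  refine (trace_mul_integral μ M hint).trans ?_
  simp only [Matrix.mul_smul, Matrix.trace_smul, smul_eq_mul]

theorem trace_conjTranspose_fourierCoeff_mul {f : G → ℂ} (hf : Integrable f μ)
    (π : UnitaryIrrep G) (M : Matrix (Fin π.dim) (Fin π.dim) ℂ) :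
    ((fourierCoeff μ f π)ᴴ * M).trace =
      ∫ g, (starRingEnd ℂ) (f g) * (π.mat g * M).trace ∂μ := by
  have h := congrArg (starRingEnd ℂ) (trace_mul_fourierCoeff μ hf π Mᴴ)
  rw [← integral_conj] at h
  simp only [map_mul] at h
  rw [starRingEnd_apply, ← Matrix.trace_conjTranspose, Matrix.conjTranspose_mul,
    Matrix.conjTranspose_conjTranspose] at h
  rw [h]
  congr 1; funext g
  rw [starRingEnd_apply ((_ : Matrix _ _ ℂ).trace), ← Matrix.trace_conjTranspose,
    Matrix.conjTranspose_mul, Matrix.conjTranspose_conjTranspose, Matrix.conjTranspose_conjTranspose]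

theorem fourierCoeff_congr_ae {f f' : G → ℂ} (h : f =ᵐ[μ] f') (π : UnitaryIrrep G) :
    fourierCoeff μ f π = fourierCoeff μ f' π := by
  ext i j
  exact integral_congr_ae (h.mono fun g hg => by simp only [hg])

theorem mat_mul_fourierCoeff [μ.IsMulRightInvariant] {f : G → ℂ} (hf : Integrable f μ) (h : G)
    (hfh : ∀ᵐ g ∂μ, f (g * h) = f g) (π : UnitaryIrrep G) :
    π.mat h * fourierCoeff μ f π = fourierCoeff μ f π := by
  refine Matrix.ext_iff_trace_mul_left.2 fun M => ?_
  rw [← Matrix.mul_assoc, trace_mul_fourierCoeff μ hf, trace_mul_fourierCoeff μ hf,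
    ← integral_mul_right_eq_self _ h]
  refine integral_congr_ae (hfh.mono fun g hg => ?_)
  simp only [hg, π.mat_mul, Matrix.conjTranspose_mul]
  rw [Matrix.mul_assoc M, ← Matrix.mul_assoc (π.mat h), π.mat_mul_conjTranspose_mat, Matrix.one_mul]

/-! ### Schur orthogonality -/

/-- Schur's lemma from the commutant form of irreducibility: `T Tᴴ` and `Tᴴ T` commute with `π` and
`σ`, so they are scalars. These scalars agree, and if `T ≠ 0` they are nonzero, which makes a
multiple of `Tᴴ` an inverse of `T`. -/
theorem intertwiner_eq_zero {π σ : UnitaryIrrep G} (hne : ¬ π.Equivalent σ)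
    {T : Matrix (Fin π.dim) (Fin σ.dim) ℂ} (hT : ∀ g, π.mat g * T = T * σ.mat g) : T = 0 := by
  by_contra hT0
  have hT' : ∀ g, σ.mat g * Tᴴ = Tᴴ * π.mat g := fun g => by
    have := congrArg Matrix.conjTranspose (hT g⁻¹)
    rw [Matrix.conjTranspose_mul, Matrix.conjTranspose_mul, π.mat_inv, σ.mat_inv,
      Matrix.conjTranspose_conjTranspose, Matrix.conjTranspose_conjTranspose] at this
    exact this.symm
  obtain ⟨c, hc⟩ := π.irreducible (T * Tᴴ) fun g => by
    change π.mat g * _ = _ * π.mat g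
    rw [← Matrix.mul_assoc, hT, Matrix.mul_assoc, hT', Matrix.mul_assoc]
  obtain ⟨c', hc'⟩ := σ.irreducible (Tᴴ * T) fun g => by
    change σ.mat g * _ = _ * σ.mat g
    rw [← Matrix.mul_assoc, hT', Matrix.mul_assoc, hT, Matrix.mul_assoc]
  have hc0 : c ≠ 0 := by
    rintro rfl
    rw [zero_smul, Matrix.self_mul_conjTranspose_eq_zero] at hc
    exact hT0 hc
  have hcc : c = c' := by
    have h1 : c • T = c' • T := by
      have := Matrix.mul_assoc T Tᴴ T
      rwa [hc, hc', Matrix.smul_mul, Matrix.mul_smul, Matrix.one_mul, Matrix.mul_one] at this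
    exact smul_left_injective ℂ hT0 h1
  refine hne ⟨T, c⁻¹ • Tᴴ, ?_, ?_, hT⟩
  · rw [Matrix.mul_smul, hc, smul_smul, inv_mul_cancel₀ hc0, one_smul]
  · rw [Matrix.smul_mul, hc', ← hcc, smul_smul, inv_mul_cancel₀ hc0, one_smul]

/-- The Haar average of `π(g) M σ(g)^*`. -/
noncomputable def schurAverage (π σ : UnitaryIrrep G) (M : Matrix (Fin π.dim) (Fin σ.dim) ℂ) :
    Matrix (Fin π.dim) (Fin σ.dim) ℂ :=
  Matrix.of fun i j => ∫ g, (π.mat g * M * (σ.mat g)ᴴ) i j ∂μ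

theorem trace_mul_schurAverage [IsFiniteMeasure μ] (π σ : UnitaryIrrep G) (M : Matrix (Fin π.dim) (Fin σ.dim) ℂ)
    (N : Matrix (Fin σ.dim) (Fin π.dim) ℂ) :
    (N * schurAverage μ π σ M).trace = ∫ g, (N * (π.mat g * M * (σ.mat g)ᴴ)).trace ∂μ := by
  exact trace_mul_integral μ N fun i j => Continuous.integrable_of_compactSpace (by fun_prop)

theorem mat_mul_schurAverage [IsFiniteMeasure μ] [μ.IsMulLeftInvariant] (π σ : UnitaryIrrep G)
    (M : Matrix (Fin π.dim) (Fin σ.dim) ℂ) (k : G) :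
    π.mat k * schurAverage μ π σ M = schurAverage μ π σ M * σ.mat k := by
  refine Matrix.ext_iff_trace_mul_left.2 fun N => ?_
  rw [← Matrix.mul_assoc, trace_mul_schurAverage, ← Matrix.mul_assoc, Matrix.trace_mul_comm,
    ← Matrix.mul_assoc, trace_mul_schurAverage]
  rw [← integral_mul_left_eq_self (fun g => (σ.mat k * N * (π.mat g * M * (σ.mat g)ᴴ)).trace) k]
  congr 1; funext g
  rw [Matrix.mul_assoc (σ.mat k), Matrix.trace_mul_comm (σ.mat k)]
  simp only [π.mat_mul, σ.mat_mul, Matrix.conjTranspose_mul, Matrix.mul_assoc,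
    σ.mat_conjTranspose_mul_mat, Matrix.mul_one]

/-- The product of the diagonal entries `(A π(g))_kk` and `(σ(g)^* B^*)_ll` is the trace of `E_lk A
π(g) E_kl σ(g)^* B^*`. Summing over `k, l` reduces both orthogonality relations to Haar averages of
matrix units. -/
theorem integral_trace_mul_conj_trace [IsFiniteMeasure μ] (π σ : UnitaryIrrep G)
    (A : Matrix (Fin π.dim) (Fin π.dim) ℂ) (B : Matrix (Fin σ.dim) (Fin σ.dim) ℂ) :
    ∫ g, (π.mat g * A).trace * (starRingEnd ℂ) (σ.mat g * B).trace ∂μ =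
      ∑ k, ∑ l, (Bᴴ * Matrix.single l k (1 : ℂ) * A * schurAverage μ π σ (Matrix.single k l (1 : ℂ)) :
        Matrix (Fin σ.dim) (Fin σ.dim) ℂ).trace := by
  simp only [trace_mul_schurAverage]
  have hc : ∀ (k : Fin π.dim) (l : Fin σ.dim), Continuous fun g : G => (Bᴴ * Matrix.single l k (1 : ℂ) * A *
      (π.mat g * Matrix.single k l (1 : ℂ) * (σ.mat g)ᴴ)).trace := fun k l => by fun_prop
  rw [Finset.sum_congr rfl fun k _ => (integral_finsetSum _ fun l _ =>
    (hc k l).integrable_of_compactSpace).symm, ← integral_finsetSum _ fun k _ =>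
    integrable_finsetSum _ fun l _ => (hc k l).integrable_of_compactSpace]
  congr 1; funext g
  rw [starRingEnd_apply, ← Matrix.trace_conjTranspose, Matrix.conjTranspose_mul,
    Matrix.trace_mul_comm (π.mat g), Matrix.trace_mul_comm Bᴴ, Matrix.trace, Matrix.trace,
    Finset.sum_mul_sum]
  refine Finset.sum_congr rfl fun k _ => Finset.sum_congr rfl fun l _ => ?_
  have h : (Bᴴ * Matrix.single l k (1 : ℂ) * A * (π.mat g * Matrix.single k l (1 : ℂ) * (σ.mat g)ᴴ)).trace =
      (Matrix.single l k (1 : ℂ) * (A * π.mat g) * Matrix.single k l (1 : ℂ) * ((σ.mat g)ᴴ * Bᴴ)).trace := by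
    rw [Matrix.mul_assoc Bᴴ, Matrix.mul_assoc Bᴴ, Matrix.trace_mul_comm Bᴴ]
    simp only [Matrix.mul_assoc]
  rw [h, Matrix.single_mul_mul_single, Matrix.trace_single_mul]
  simp

theorem integral_schur_of_not_equivalent [IsFiniteMeasure μ] [μ.IsMulLeftInvariant]
    {π σ : UnitaryIrrep G} (hne : ¬ π.Equivalent σ) (A : Matrix (Fin π.dim) (Fin π.dim) ℂ)
    (B : Matrix (Fin σ.dim) (Fin σ.dim) ℂ) :
    ∫ g, (π.mat g * A).trace * (starRingEnd ℂ) (σ.mat g * B).trace ∂μ = 0 := by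
  rw [integral_trace_mul_conj_trace]
  simp only [intertwiner_eq_zero hne (mat_mul_schurAverage μ π σ _), Matrix.mul_zero,
    Matrix.trace_zero, Finset.sum_const_zero]

theorem integral_schur_self [IsProbabilityMeasure μ] [μ.IsMulLeftInvariant]
    (π : UnitaryIrrep G) (A B : Matrix (Fin π.dim) (Fin π.dim) ℂ) :
    ∫ g, (π.mat g * A).trace * (starRingEnd ℂ) (π.mat g * B).trace ∂μ =
      (π.dim : ℂ)⁻¹ * (Bᴴ * A).trace := by
  have hd : (π.dim : ℂ) ≠ 0 := Nat.cast_ne_zero.2 π.dim_pos.ne'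
  -- The average commutes with `π`, so it is scalar; conjugation by `π(g)` preserves the trace,
  -- which fixes the scalar.
  have hS : ∀ M, schurAverage μ π π M = ((π.dim : ℂ)⁻¹ * M.trace) • 1 := fun M => by
    obtain ⟨c, hc⟩ := π.irreducible _ (mat_mul_schurAverage μ π π M)
    have ht : (1 * schurAverage μ π π M).trace = M.trace := by
      rw [trace_mul_schurAverage]
      have : ∀ g, (1 * (π.mat g * M * (π.mat g)ᴴ)).trace = M.trace := fun g => by
        rw [Matrix.one_mul, Matrix.mul_assoc, Matrix.trace_mul_comm, Matrix.mul_assoc,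
          π.mat_conjTranspose_mul_mat, Matrix.mul_one]
      simp only [this, integral_const, probReal_univ, one_smul]
    rw [Matrix.one_mul, hc, Matrix.trace_smul, Matrix.trace_one, Fintype.card_fin,
      smul_eq_mul] at ht
    rw [hc, ← ht]
    congr 1
    field_simp
  rw [integral_trace_mul_conj_trace]
  simp only [hS, Matrix.mul_smul, Matrix.mul_one, Matrix.trace_smul, smul_eq_mul]
  have : ∀ k, ∑ l, (π.dim : ℂ)⁻¹ * (Matrix.single k l (1 : ℂ)).trace *
      (Bᴴ * Matrix.single l k 1 * A).trace =
      (π.dim : ℂ)⁻¹ * (Bᴴ * Matrix.single k k 1 * A).trace := fun k => by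
    rw [Finset.sum_eq_single k]
    · simp
    · intro l _ hl
      rw [Matrix.trace_single_eq_of_ne _ _ _ hl.symm]; simp
    · simp
  rw [Finset.sum_congr rfl fun k _ => this k, ← Finset.mul_sum, ← Matrix.trace_sum,
    ← Finset.sum_mul, ← Finset.mul_sum, Matrix.sum_single_one, Matrix.mul_one]

end Group

/-! ### Correlations, convolutions and Plancherel for finite sums. -/

section Convolution

variable {G : Type*} [Group G] [TopologicalSpace G] [IsTopologicalGroup G] [CompactSpace G]
  [SecondCountableTopology G] [MeasurableSpace G] [BorelSpace G] (μ : Measure G)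

/-- Fourier coefficients of a correlation `k ↦ ∫ conj(s(g)) s(gk) dg`. -/
theorem fourierCoeff_correlation [IsFiniteMeasure μ] [μ.IsMulLeftInvariant] {s : G → ℂ}
    (hs : Integrable s μ) (π : UnitaryIrrep G) :
    fourierCoeff μ (fun k => ∫ g, (starRingEnd ℂ) (s g) * s (g * k) ∂μ) π =
      fourierCoeff μ s π * (fourierCoeff μ s π)ᴴ := by
  have hs' : Integrable (fun g => (starRingEnd ℂ) (s g)) μ :=
    memLp_one_iff_integrable.1 (memLp_one_iff_integrable.2 hs).star
  -- The shear `(g, k) ↦ (g, gk)` preserves the product measure and reduces this to a product of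
  -- integrable functions.
  have hint : Integrable (fun z : G × G => (starRingEnd ℂ) (s z.1) * s (z.1 * z.2)) (μ.prod μ) :=
    (measurePreserving_prod_mul μ μ).integrable_comp_of_integrable
      (g := fun z : G × G => (starRingEnd ℂ) (s z.1) * s z.2) (hs'.mul_prod hs)
  refine Matrix.ext_iff_trace_mul_left.2 fun M => ?_
  rw [trace_mul_fourierCoeff μ hint.integral_prod_right, ← Matrix.mul_assoc,
    Matrix.trace_mul_comm, trace_conjTranspose_fourierCoeff_mul μ hs]
  simp only [← integral_mul_const]
  rw [integral_integral_swap]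
  · congr 1; funext g
    rw [← Matrix.mul_assoc, trace_mul_fourierCoeff μ hs,
      ← integral_mul_left_eq_self (fun k => s k * (π.mat g * M * (π.mat k)ᴴ).trace) g,
      ← integral_const_mul]
    congr 1; funext k
    rw [mul_assoc, π.mat_mul, Matrix.conjTranspose_mul, ← Matrix.mul_assoc _ (π.mat k)ᴴ,
      Matrix.trace_mul_comm _ (π.mat g)ᴴ, ← Matrix.mul_assoc, ← Matrix.mul_assoc,
      π.mat_conjTranspose_mul_mat, Matrix.one_mul]
  · obtain ⟨C, hC⟩ := (isCompact_range
      (show Continuous fun k : G => (M * (π.mat k)ᴴ).trace by fun_prop)).isBounded.exists_norm_le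
    refine hint.swap.mul_bdd (c := C) ?_ (.of_forall fun z => hC _ ⟨z.1, rfl⟩)
    exact (show Continuous fun z : G × G => (M * (π.mat z.1)ᴴ).trace by
      fun_prop).aestronglyMeasurable

/-- The convolution `f * s^*`, `(f * s^*)(g) = ∫ f(h) conj(s(g⁻¹h)) dh`. -/
noncomputable def convStar (f s : G → ℂ) (g : G) : ℂ :=
  ∫ h, f h * (starRingEnd ℂ) (s (g⁻¹ * h)) ∂μ

/-- Replacing `h` by `gh` splits off `π(g)`; the integral that remains is the adjoint Fourier
coefficient of `s`. -/
theorem convStar_trace [μ.IsMulLeftInvariant] {f s : G → ℂ} (hs : Integrable s μ)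
    (π : UnitaryIrrep G) (A : Matrix (Fin π.dim) (Fin π.dim) ℂ)
    (hf : f =ᵐ[μ] fun g => (π.mat g * A).trace) (g : G) :
    convStar μ f s g = (π.mat g * ((fourierCoeff μ s π)ᴴ * A)).trace := by
  rw [Matrix.trace_mul_comm, Matrix.mul_assoc, trace_conjTranspose_fourierCoeff_mul μ hs, convStar]
  rw [integral_congr_ae (hf.mono fun h hh => by rw [hh]),
    ← integral_mul_left_eq_self _ g]
  congr 1; funext h
  beta_reduce
  rw [inv_mul_cancel_left, mul_comm, π.mat_mul, Matrix.mul_assoc, Matrix.trace_mul_comm,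
    Matrix.mul_assoc]

omit [Group G] [IsTopologicalGroup G] [CompactSpace G] [SecondCountableTopology G]
  [TopologicalSpace G] [BorelSpace G] in
theorem continuous_integral_mul {u : G → ℂ} (hu : MemLp u 2 μ) :
    Continuous fun f : Lp ℂ 2 μ => ∫ g, f g * u g ∂μ := by
  have hu' : MemLp (fun g => (starRingEnd ℂ) (u g)) 2 μ := hu.star
  have : (fun f : Lp ℂ 2 μ => ∫ g, f g * u g ∂μ) = fun f => inner ℂ (hu'.toLp _) f := by
    funext f
    rw [L2.inner_def]
    refine integral_congr_ae (hu'.coeFn_toLp.mono fun g hg => ?_)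
    simp only [hg]
    simp [mul_comm]
  rw [this]
  fun_prop

theorem memLp_conj_translate [μ.IsMulLeftInvariant] {s : G → ℂ} (hs : MemLp s 2 μ) (g : G) :
    MemLp (fun h => (starRingEnd ℂ) (s (g⁻¹ * h))) 2 μ :=
  (hs.comp_measurePreserving (measurePreserving_mul_left μ g⁻¹)).star

theorem continuous_convStar [μ.IsMulLeftInvariant] {s : G → ℂ} (hs : MemLp s 2 μ) (g : G) :
    Continuous fun f : Lp ℂ 2 μ => convStar μ f s g :=
  continuous_integral_mul μ (memLp_conj_translate μ hs g)

theorem convStar_add [μ.IsMulLeftInvariant] {s : G → ℂ} (hs : MemLp s 2 μ)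
    (f₁ f₂ : Lp ℂ 2 μ) (g : G) :
    convStar μ (f₁ + f₂ : Lp ℂ 2 μ) s g = convStar μ f₁ s g + convStar μ f₂ s g := by
  have hu := memLp_conj_translate μ hs g
  have hi : ∀ f : Lp ℂ 2 μ, Integrable (fun h => f h * (starRingEnd ℂ) (s (g⁻¹ * h))) μ :=
    fun f => (Lp.memLp f).integrable_mul hu
  rw [convStar, convStar, convStar, ← integral_add (hi f₁) (hi f₂)]
  refine integral_congr_ae ((Lp.coeFn_add f₁ f₂).mono fun h hh => ?_)
  simp only [hh, Pi.add_apply]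
  ring

omit [IsTopologicalGroup G] [CompactSpace G] [SecondCountableTopology G]
  [TopologicalSpace G] [BorelSpace G] in
theorem convStar_smul (s : G → ℂ) (c : ℂ) (f : Lp ℂ 2 μ) (g : G) :
    convStar μ (c • f : Lp ℂ 2 μ) s g = c * convStar μ f s g := by
  rw [convStar, convStar, ← integral_const_mul]
  refine integral_congr_ae ((Lp.coeFn_smul c f).mono fun h hh => ?_)
  simp only [hh, Pi.smul_apply, smul_eq_mul]
  ring

theorem continuous_fourierCoeff [IsFiniteMeasure μ] (π : UnitaryIrrep G) :
    Continuous fun f : Lp ℂ 2 μ => fourierCoeff μ f π :=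
  continuous_matrix fun i j => continuous_integral_mul μ (u := fun g => (π.mat g)ᴴ i j)
    (Continuous.memLp_of_compactSpace (by fun_prop))

theorem fourierCoeff_add [IsFiniteMeasure μ] (π : UnitaryIrrep G) (f₁ f₂ : Lp ℂ 2 μ) :
    fourierCoeff μ (f₁ + f₂ : Lp ℂ 2 μ) π = fourierCoeff μ f₁ π + fourierCoeff μ f₂ π := by
  have hi : ∀ f : Lp ℂ 2 μ, Integrable f μ := fun f => (Lp.memLp f).integrable (by norm_num)
  rw [fourierCoeff_congr_ae μ (Lp.coeFn_add f₁ f₂)]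
  refine Matrix.ext_iff_trace_mul_left.2 fun M => ?_
  rw [Matrix.mul_add, Matrix.trace_add, trace_mul_fourierCoeff μ ((hi f₁).add (hi f₂)),
    trace_mul_fourierCoeff μ (hi f₁), trace_mul_fourierCoeff μ (hi f₂), ← integral_add
    ((hi f₁).mul_continuous (by fun_prop)) ((hi f₂).mul_continuous (by fun_prop))]
  simp only [Pi.add_apply, add_mul]

/-- Plancherel for finite sums of matrix coefficients of pairwise inequivalent representations. -/
theorem integral_norm_sq_sum_trace [IsProbabilityMeasure μ] [μ.IsMulLeftInvariant] {ι : Type*}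
    (s : Finset ι) (π : ι → UnitaryIrrep G)
    (hπ : ∀ i j, i ≠ j → ¬ (π i).Equivalent (π j))
    (A : ∀ i, Matrix (Fin (π i).dim) (Fin (π i).dim) ℂ) :
    ((∫ g, ‖∑ i ∈ s, ((π i).mat g * A i).trace‖ ^ 2 ∂μ : ℝ) : ℂ) =
      ∑ i ∈ s, ((π i).dim : ℂ)⁻¹ * ((A i)ᴴ * A i).trace := by
  rw [← integral_complex_ofReal]
  have hc : ∀ i j, Integrable (fun g => ((π i).mat g * A i).trace *
      (starRingEnd ℂ) ((π j).mat g * A j).trace) μ := fun i j =>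
    Continuous.integrable_of_compactSpace (by
      refine Continuous.mul (by fun_prop) (Complex.continuous_conj.comp (by fun_prop)))
  have : ∀ g, ((‖∑ i ∈ s, ((π i).mat g * A i).trace‖ ^ 2 : ℝ) : ℂ) =
      ∑ i ∈ s, ∑ j ∈ s, ((π i).mat g * A i).trace * (starRingEnd ℂ) ((π j).mat g * A j).trace := by
    intro g
    rw [← Finset.sum_mul_sum, ← map_sum, Complex.mul_conj, Complex.normSq_eq_norm_sq]
  simp only [this]
  rw [integral_finsetSum _ fun i _ => integrable_finsetSum _ fun j _ => hc i j]
  refine Finset.sum_congr rfl fun i hi => ?_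
  rw [integral_finsetSum _ fun j _ => hc i j, Finset.sum_eq_single i, integral_schur_self]
  · exact fun j _ hj => integral_schur_of_not_equivalent μ (hπ i j hj.symm) _ _
  · exact fun h => (h hi).elim

end Convolution

/-! ### Transfer from the homogeneous space to the group. -/

section Homogeneous

variable {G : Type*} [Group G] [TopologicalSpace G] [IsTopologicalGroup G] [CompactSpace G]
  [SecondCountableTopology G] [MeasurableSpace G] [BorelSpace G] (μ : Measure G)
  {X : Type*} [TopologicalSpace X] [MeasurableSpace X] [BorelSpace X]
  [MulAction G X] [ContinuousSMul G X] (x₀ : X)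

theorem measurePreserving_orbit : MeasurePreserving (fun g : G => g • x₀) μ (orbitMeasure μ x₀) :=
  ⟨(continuous_id.smul continuous_const).measurable, rfl⟩

theorem lift_ae_eq_liftL2 (φ : Lp ℂ 2 (orbitMeasure μ x₀)) :
    lift x₀ φ =ᵐ[μ] liftL2 μ x₀ φ :=
  (Lp.coeFn_compMeasurePreserving φ (measurePreserving_orbit μ x₀)).symm

theorem memLp_lift (φ : Lp ℂ 2 (orbitMeasure μ x₀)) : MemLp (lift x₀ φ) 2 μ :=
  (Lp.memLp φ).comp_measurePreserving (measurePreserving_orbit μ x₀)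

theorem fourierCoeffX_zonalProd [IsFiniteMeasure μ] [μ.IsMulLeftInvariant]
    (φ : Lp ℂ 2 (orbitMeasure μ x₀)) (π : UnitaryIrrep G) :
    fourierCoeffX μ x₀ (zonalProd μ x₀ φ φ) π =
      fourierCoeff μ (liftL2 μ x₀ φ) π * (fourierCoeff μ (liftL2 μ x₀ φ) π)ᴴ := by
  rw [← fourierCoeff_congr_ae μ (lift_ae_eq_liftL2 μ x₀ φ),
    ← fourierCoeff_correlation μ ((memLp_lift μ x₀ φ).integrable (by norm_num)), fourierCoeffX]
  congr 1; funext k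
  simp only [lift, zonalProd, smul_smul]

/-- Equality holds at every `z`: passing to `L²` representatives changes the integrand only on a
null set, because left translation preserves null sets. -/
theorem waveletTransform_eq_convStar [μ.IsMulLeftInvariant]
    (ψ : ℝ → Lp ℂ 2 (orbitMeasure μ x₀)) (φ : Lp ℂ 2 (orbitMeasure μ x₀)) (z : ℝ × G) :
    waveletTransform (orbitMeasure μ x₀) ψ φ z =
      convStar μ (liftL2 μ x₀ φ) (liftL2 μ x₀ (ψ z.1)) z.2 := by
  have hm : AEStronglyMeasurable
      (fun x => φ x * (starRingEnd ℂ) (ψ z.1 (z.2⁻¹ • x))) (orbitMeasure μ x₀) :=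
    ((Lp.stronglyMeasurable φ).mul (Complex.continuous_conj.comp_stronglyMeasurable
      ((Lp.stronglyMeasurable (ψ z.1)).comp_measurable
        (continuous_const_smul z.2⁻¹).measurable))).aestronglyMeasurable
  rw [waveletTransform, bulletProd, convStar]
  refine (integral_map (measurePreserving_orbit μ x₀).measurable.aemeasurable hm).trans ?_
  have h := (measurePreserving_mul_left μ z.2⁻¹).quasiMeasurePreserving.ae_eq_comp
    (lift_ae_eq_liftL2 μ x₀ (ψ z.1))
  refine integral_congr_ae ?_
  filter_upwards [lift_ae_eq_liftL2 μ x₀ φ, h] with g hg hg'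
  simp only [Function.comp_apply] at hg'
  rw [← hg, ← hg', smul_smul]
  rfl

theorem fourierCoeff_liftL2_invariant [IsFiniteMeasure μ] [μ.IsMulRightInvariant]
    (φ : Lp ℂ 2 (orbitMeasure μ x₀)) (π : UnitaryIrrep G) {h : G}
    (hh : h ∈ MulAction.stabilizer G x₀) :
    π.mat h * fourierCoeff μ (liftL2 μ x₀ φ) π = fourierCoeff μ (liftL2 μ x₀ φ) π := by
  rw [← fourierCoeff_congr_ae μ (lift_ae_eq_liftL2 μ x₀ φ)]
  refine mat_mul_fourierCoeff μ ((memLp_lift μ x₀ φ).integrable (by norm_num)) h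
    (.of_forall fun g => ?_) π
  rw [lift, lift, mul_smul, MulAction.mem_stabilizer_iff.1 hh]

theorem integrable_translates [IsFiniteMeasure μ] [μ.IsMulLeftInvariant] [μ.IsMulRightInvariant]
    (H : Subgroup G) (μH : Measure H) [IsProbabilityMeasure μH] {f : G → ℂ} (hf : Integrable f μ) :
    Integrable (fun z : (H × H) × G => f (z.1.1 * z.2 * z.1.2)) ((μH.prod μH).prod μ) := by
  have h : MeasurePreserving (fun z : (H × H) × G => (z.1, (z.1.1 * z.2 * z.1.2 : G)))
      ((μH.prod μH).prod μ) ((μH.prod μH).prod μ) := by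
    refine MeasurePreserving.skew_product (g := fun (z : H × H) (g : G) => (z.1 * g * z.2 : G))
      (MeasurePreserving.id _) (by unfold Function.uncurry; fun_prop) (.of_forall fun z => ?_)
    exact ((measurePreserving_mul_right μ (z.2 : G)).comp
      (measurePreserving_mul_left μ (z.1 : G))).map_eq
  exact (measurePreserving_snd.comp h).integrable_comp_of_integrable hf

/-- Translating the variable moves `h₁` and `h₂` from `f` to `π(g)^*`, where they meet `M` on its
two sides (cyclicity of the trace) and are absorbed. -/
theorem trace_mul_fourierCoeffX_zonalAverage [IsFiniteMeasure μ] [μ.IsMulLeftInvariant]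
    [μ.IsMulRightInvariant] [MulAction.IsPretransitive G X]
    (μH : Measure (MulAction.stabilizer G x₀)) [IsProbabilityMeasure μH] [μH.IsMulLeftInvariant]
    {f : G → ℂ} (hf : Integrable f μ) (π : UnitaryIrrep G) (M : Matrix (Fin π.dim) (Fin π.dim) ℂ)
    (hM : ∀ h ∈ MulAction.stabilizer G x₀, π.mat h * M = M ∧ M * π.mat h = M) :
    (M * fourierCoeffX μ x₀ (zonalAverage x₀ μH f) π).trace = (M * fourierCoeff μ f π).trace := by
  have hF := integrable_translates μ (MulAction.stabilizer G x₀) μH hf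
  -- The iterated integral over `H` is identified with the product integral only where the latter
  -- converges, that is, for almost every `g`.
  have hz : lift x₀ (zonalAverage x₀ μH f) =ᵐ[μ]
      fun g => ∫ z, f (z.1 * g * z.2) ∂μH.prod μH := by
    filter_upwards [hF.prod_left_ae] with g hg
    rw [lift, zonalAverage_smul]
    exact (integral_prod _ hg).symm
  rw [fourierCoeffX, fourierCoeff_congr_ae μ hz, trace_mul_fourierCoeff μ hF.integral_prod_right,
    trace_mul_fourierCoeff μ hf]
  simp only [← integral_mul_const]
  rw [integral_integral_swap]
  · have : ∀ z : MulAction.stabilizer G x₀ × MulAction.stabilizer G x₀,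
        ∫ g, f (z.1 * g * z.2) * (M * (π.mat g)ᴴ).trace ∂μ =
          ∫ g, f g * (M * (π.mat g)ᴴ).trace ∂μ := fun z => by
      rw [← integral_mul_right_eq_self (fun g => f g * (M * (π.mat g)ᴴ).trace) (z.2 : G),
        ← integral_mul_left_eq_self (fun g => f (g * z.2) * (M * (π.mat (g * z.2))ᴴ).trace)
          (z.1 : G)]
      congr 1; funext g
      rw [π.mat_mul, π.mat_mul, Matrix.conjTranspose_mul, Matrix.conjTranspose_mul,
        ← Matrix.mul_assoc, ← π.mat_inv z.2, (hM _ (inv_mem z.2.2)).2, ← Matrix.mul_assoc,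
        Matrix.trace_mul_comm (M * _), ← Matrix.mul_assoc, ← π.mat_inv z.1,
        (hM _ (inv_mem z.1.2)).1]
    simp only [this, integral_const, probReal_univ, one_smul]
  · obtain ⟨C, hC⟩ := (isCompact_range
      (show Continuous fun k : G => (M * (π.mat k)ᴴ).trace by fun_prop)).isBounded.exists_norm_le
    refine hF.swap.mul_bdd (c := C) ?_ (.of_forall fun z => hC _ ⟨z.1, rfl⟩)
    exact ((show Continuous fun g : G => (M * (π.mat g)ᴴ).trace by
      fun_prop).measurable.comp measurable_fst).aestronglyMeasurable

end Homogeneous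

/-! ### Density of the invariant matrix coefficients. -/

section Density

variable {G : Type*} [Group G] [TopologicalSpace G]

/-- A representative of a class in the unitary dual. -/
noncomputable def UnitaryDual.rep (q : UnitaryDual G) : UnitaryIrrep G := Quotient.out q

theorem UnitaryDual.cls_rep (q : UnitaryDual G) : q.rep.cls = q := Quotient.out_eq q

theorem UnitaryDual.rep_cls_equivalent (π : UnitaryIrrep G) : π.cls.rep.Equivalent π :=
  Quotient.exact (s := irrepSetoid G) π.cls.cls_rep

theorem UnitaryDual.eq_of_rep_equivalent {q r : UnitaryDual G} (h : q.rep.Equivalent r.rep) :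
    q = r := by
  rw [← q.cls_rep, ← r.cls_rep]
  exact Quotient.sound (s := irrepSetoid G) h

variable [MeasurableSpace G] (μ : Measure G)

theorem coeffSpace_le_of_equivalent {π σ : UnitaryIrrep G} (h : σ.Equivalent π) :
    coeffSpace μ π ≤ coeffSpace μ σ := by
  rintro f ⟨A, hA⟩
  obtain ⟨C, B, hCB, hBC, hC⟩ := h
  refine ⟨C * A * B, hA.trans (.of_forall fun g => ?_)⟩
  beta_reduce
  rw [← Matrix.mul_assoc, ← Matrix.mul_assoc, hC, Matrix.trace_mul_comm _ B, Matrix.mul_assoc C,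
    ← Matrix.mul_assoc B, hBC, Matrix.one_mul]

/-- The functions `g ↦ tr(π(g) A)` with `π(h) A = A` for `h` in the subgroup `H`. -/
noncomputable def invariantCoeffSpace (H : Subgroup G) (π : UnitaryIrrep G) : Submodule ℂ (Lp ℂ 2 μ) where
  carrier := {f | ∃ A : Matrix (Fin π.dim) (Fin π.dim) ℂ, (∀ h ∈ H, π.mat h * A = A) ∧
    (f : G → ℂ) =ᵐ[μ] fun g => (π.mat g * A).trace}
  zero_mem' := ⟨0, by simp, by
    filter_upwards [Lp.coeFn_zero ℂ 2 μ] with g hg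
    rw [hg]
    simp⟩
  add_mem' := by
    rintro f₁ f₂ ⟨A, hA', hA⟩ ⟨B, hB', hB⟩
    refine ⟨A + B, fun h hh => by rw [Matrix.mul_add, hA' h hh, hB' h hh], ?_⟩
    filter_upwards [Lp.coeFn_add f₁ f₂, hA, hB] with g h h₁ h₂
    rw [h, Pi.add_apply, h₁, h₂, Matrix.mul_add, Matrix.trace_add]
  smul_mem' := by
    rintro c f ⟨A, hA', hA⟩
    refine ⟨c • A, fun h hh => by rw [Matrix.mul_smul, hA' h hh], ?_⟩
    filter_upwards [Lp.coeFn_smul c f, hA] with g h h₁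
    rw [h, Pi.smul_apply, h₁, Matrix.mul_smul, Matrix.trace_smul]

/-- The span of the right `H`-invariant matrix coefficients of the classes in `Ĝ₊`. -/
noncomputable def invariantSpan (H : Subgroup G) (Gplus : Set (UnitaryDual G)) : Submodule ℂ (Lp ℂ 2 μ) :=
  ⨆ q : Gplus, invariantCoeffSpace μ H q.1.rep

variable [IsTopologicalGroup G] [CompactSpace G] [SecondCountableTopology G] [BorelSpace G]

theorem integrable_lp [IsFiniteMeasure μ] (f : Lp ℂ 2 μ) : Integrable f μ :=
  (Lp.memLp f).integrable (by norm_num)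

theorem inner_trace_eq [IsFiniteMeasure μ] {e : Lp ℂ 2 μ} (f : Lp ℂ 2 μ) (π : UnitaryIrrep G)
    (A : Matrix (Fin π.dim) (Fin π.dim) ℂ) (he : e =ᵐ[μ] fun g => (π.mat g * A).trace) :
    inner ℂ e f = (Aᴴ * fourierCoeff μ f π).trace := by
  rw [L2.inner_def, trace_mul_fourierCoeff μ (integrable_lp μ f)]
  refine integral_congr_ae (he.mono fun g hg => ?_)
  simp only [hg]
  rw [RCLike.inner_apply, starRingEnd_apply, ← Matrix.trace_conjTranspose,
    Matrix.conjTranspose_mul]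

theorem fourierCoeff_invariant_of_mem_closure [IsProbabilityMeasure μ] [μ.IsMulRightInvariant]
    (H : Subgroup G) (Gplus : Set (UnitaryDual G)) {f : Lp ℂ 2 μ}
    (hf : f ∈ (invariantSpan μ H Gplus).topologicalClosure) (π : UnitaryIrrep G) {h : G}
    (hh : h ∈ H) : π.mat h * fourierCoeff μ f π = fourierCoeff μ f π := by
  have hclosed : IsClosed {f : Lp ℂ 2 μ | π.mat h * fourierCoeff μ f π = fourierCoeff μ f π} :=
    isClosed_eq (continuous_const.matrix_mul (continuous_fourierCoeff μ π))
      (continuous_fourierCoeff μ π)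
  refine closure_minimal (fun f hf => ?_) hclosed hf
  refine Submodule.iSup_induction _ (motive := fun f : Lp ℂ 2 μ =>
    π.mat h * fourierCoeff μ f π = fourierCoeff μ f π) hf ?_ ?_ ?_
  · rintro q f ⟨A, hA, hfA⟩
    refine mat_mul_fourierCoeff μ (integrable_lp μ f) h ?_ π
    filter_upwards [hfA, (measurePreserving_mul_right μ h).quasiMeasurePreserving.ae_eq_comp hfA]
      with g hg hg'
    simp only [Function.comp_apply] at hg'
    rw [hg, hg', UnitaryIrrep.mat_mul, Matrix.mul_assoc, hA h hh]
  · rw [fourierCoeff_congr_ae μ (Lp.coeFn_zero ℂ 2 μ)]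
    have : fourierCoeff μ (0 : G → ℂ) π = 0 := by
      ext i j; simp [fourierCoeff]
    rw [this, Matrix.mul_zero]
  · intro f₁ f₂ h₁ h₂
    rw [fourierCoeff_add, Matrix.mul_add, h₁, h₂]

/-- Split `f` orthogonally along the closed span. The remainder `r` has `H`-invariant Fourier
coefficients, and testing it against the matrix coefficients they define shows that they vanish on
`Ĝ₊`. So `r` is orthogonal to all of `L²_0(G)`, in particular to `f`, which forces `r = 0`. -/
theorem mem_closure_invariantSpan [IsProbabilityMeasure μ] [μ.IsMulRightInvariant]
    (H : Subgroup G) (Gplus : Set (UnitaryDual G)) {f : Lp ℂ 2 μ} (hf : f ∈ L2ZeroGroup μ Gplus)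
    (hinv : ∀ π : UnitaryIrrep G, ∀ h ∈ H, π.mat h * fourierCoeff μ f π = fourierCoeff μ f π) :
    f ∈ (invariantSpan μ H Gplus).topologicalClosure := by
  set K := (invariantSpan μ H Gplus).topologicalClosure with hK
  have : CompleteSpace K := (Submodule.isClosed_topologicalClosure _).completeSpace_coe
  obtain ⟨p, hp, r, hr, rfl⟩ := K.exists_add_mem_mem_orthogonal f
  have hrinv : ∀ π : UnitaryIrrep G, ∀ h ∈ H,
      π.mat h * fourierCoeff μ r π = fourierCoeff μ r π := fun π h hh => by
    have h₁ := hinv π h hh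
    rw [fourierCoeff_add, Matrix.mul_add,
      fourierCoeff_invariant_of_mem_closure μ H Gplus hp π hh] at h₁
    exact add_left_cancel h₁
  have hr0 : ∀ q ∈ Gplus, fourierCoeff μ r q.rep = 0 := fun q hq => by
    have hc : MemLp (fun g => (q.rep.mat g * fourierCoeff μ r q.rep).trace) 2 μ :=
      Continuous.memLp_of_compactSpace (by fun_prop)
    -- Invariance of the coefficient of `r` is exactly what puts this test function in the span;
    -- orthogonality then says `tr(r̂^* r̂) = 0`.
    have hmem : hc.toLp _ ∈ K := Submodule.le_topologicalClosure _
      (Submodule.mem_iSup_of_mem (⟨q, hq⟩ : Gplus) ⟨_, hrinv q.rep, hc.coeFn_toLp⟩)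
    have := (Submodule.mem_orthogonal K r).1 hr _ hmem
    rw [inner_trace_eq μ r q.rep _ hc.coeFn_toLp] at this
    exact Matrix.trace_conjTranspose_mul_self_eq_zero_iff.1 this
  have hle : L2ZeroGroup μ Gplus ≤ (ℂ ∙ r)ᗮ := by
    refine Submodule.topologicalClosure_minimal _ (iSup₂_le fun π hπ => ?_)
      (Submodule.isClosed_orthogonal _)
    refine (coeffSpace_le_of_equivalent μ (UnitaryDual.rep_cls_equivalent π)).trans ?_
    rintro e ⟨A, hA⟩
    rw [Submodule.mem_orthogonal_singleton_iff_inner_left, inner_trace_eq μ r _ A hA,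
      hr0 _ hπ, Matrix.mul_zero, Matrix.trace_zero]
  have h0 : inner ℂ (p + r) r = 0 :=
    (Submodule.mem_orthogonal_singleton_iff_inner_left).1 (hle hf)
  rw [inner_add_left, (Submodule.mem_orthogonal K r).1 hr p hp, zero_add, inner_self_eq_zero] at h0
  rw [h0, add_zero]
  exact hp

end Density

theorem norm_sq_eq_integral_norm_sq {Ω : Type*} [MeasurableSpace Ω] {ν : Measure Ω}
    (f : Lp ℂ 2 ν) : ‖f‖ ^ 2 = ∫ x, ‖f x‖ ^ 2 ∂ν := by
  have h : ((‖f‖ ^ 2 : ℝ) : ℂ) = ((∫ x, ‖f x‖ ^ 2 ∂ν : ℝ) : ℂ) := by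
    have h' := inner_self_eq_norm_sq_to_K (𝕜 := ℂ) f
    rw [← integral_complex_ofReal, Complex.ofReal_pow]
    refine h'.symm.trans ((L2.inner_def f f).trans (integral_congr_ae (.of_forall fun x => ?_)))
    simp only [inner_self_eq_norm_sq_to_K]
    simp
  exact_mod_cast h

/-! ### The norm identity on finite sums. -/

section Isometry

variable {G : Type*} [Group G] [TopologicalSpace G] [IsTopologicalGroup G] [CompactSpace G]
  [SecondCountableTopology G] [MeasurableSpace G] [BorelSpace G] (μ : Measure G)
  (H : Subgroup G) (Gplus : Set (UnitaryDual G)) (α : ℝ → ℝ) (S : ℝ → Lp ℂ 2 μ)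

theorem exists_sum_of_mem_invariantSpan {f : Lp ℂ 2 μ} (hf : f ∈ invariantSpan μ H Gplus) :
    ∃ (s : Finset Gplus) (A : ∀ q : Gplus, Matrix (Fin q.1.rep.dim) (Fin q.1.rep.dim) ℂ),
      (∀ q, ∀ h ∈ H, q.1.rep.mat h * A q = A q) ∧
      f =ᵐ[μ] fun g => ∑ q ∈ s, (q.1.rep.mat g * A q).trace := by
  obtain ⟨F, hF, rfl⟩ := (Submodule.mem_iSup_iff_exists_finsupp _ _).1 hf
  choose A hA hFA using hF
  refine ⟨F.support, A, hA, ?_⟩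
  have h : ∀ s : Finset Gplus, ((∑ q ∈ s, F q : Lp ℂ 2 μ) : G → ℂ) =ᵐ[μ]
      fun g => ∑ q ∈ s, (q.1.rep.mat g * A q).trace := fun s => by
    classical
    induction s using Finset.induction_on with
    | empty =>
      simp only [Finset.sum_empty]
      exact Lp.coeFn_zero ℂ 2 μ
    | insert q s hq ih =>
      rw [Finset.sum_insert hq]
      filter_upwards [Lp.coeFn_add (F q) (∑ q ∈ s, F q), hFA q, ih] with g h₁ h₂ h₃
      rw [h₁, Pi.add_apply, h₂, h₃, Finset.sum_insert hq]
  exact h _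

theorem convStar_sum [IsFiniteMeasure μ] [μ.IsMulLeftInvariant] {ι : Type*} (s : Finset ι)
    (π : ι → UnitaryIrrep G)
    (A : ∀ i, Matrix (Fin (π i).dim) (Fin (π i).dim) ℂ) {f : G → ℂ}
    (hf : f =ᵐ[μ] fun g => ∑ i ∈ s, ((π i).mat g * A i).trace) (u : Lp ℂ 2 μ) (g : G) :
    convStar μ f u g =
      ∑ i ∈ s, ((π i).mat g * ((fourierCoeff μ u (π i))ᴴ * A i)).trace := by
  have hu := memLp_conj_translate μ (Lp.memLp u) g
  rw [Finset.sum_congr rfl fun i _ =>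
    (convStar_trace μ (integrable_lp μ u) (π i) (A i) ae_eq_rfl g).symm]
  simp only [convStar]
  have hi : ∀ i ∈ s, Integrable
      (fun h => ((π i).mat h * A i).trace * (starRingEnd ℂ) (u (g⁻¹ * h))) μ := fun i _ =>
    MemLp.integrable_mul (p := 2) (q := 2)
      (Continuous.memLp_of_compactSpace (u := fun h => ((π i).mat h * A i).trace) (by fun_prop)) hu
  rw [← integral_finsetSum _ hi]
  exact integral_congr_ae (hf.mono fun h hh => by
    beta_reduce at hh ⊢
    rw [hh, Finset.sum_mul])

theorem aestronglyMeasurable_sum_trace [IsFiniteMeasure μ] {ν : Measure ℝ} {ι : Type*}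
    (s : Finset ι) (π : ι → UnitaryIrrep G)
    (A : ∀ i, Matrix (Fin (π i).dim) (Fin (π i).dim) ℂ) (hS : AEStronglyMeasurable S ν) :
    AEStronglyMeasurable (fun z : ℝ × G =>
      ∑ i ∈ s, ((π i).mat z.2 * ((fourierCoeff μ (S z.1) (π i))ᴴ * A i)).trace) (ν.prod μ) := by
  refine Finset.aestronglyMeasurable_fun_sum _ fun i _ => ?_
  have hF : ∀ a b, AEStronglyMeasurable (fun z : ℝ × G => fourierCoeff μ (S z.1) (π i) a b)
      (ν.prod μ) := fun a b =>
    (((continuous_fourierCoeff μ (π i)).matrix_elem a b).comp_aestronglyMeasurable hS).comp_fst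
  have hG : ∀ a b, AEStronglyMeasurable (fun z : ℝ × G => (π i).mat z.2 a b) (ν.prod μ) :=
    fun a b => (((π i).continuous_mat.matrix_elem a b).measurable.comp
      measurable_snd).aestronglyMeasurable
  simp only [Matrix.trace, Matrix.diag_apply, Matrix.mul_apply, Matrix.conjTranspose_apply]
  exact Finset.aestronglyMeasurable_fun_sum _ fun a _ =>
    Finset.aestronglyMeasurable_fun_sum _ fun b _ => (hG a b).mul
      (Finset.aestronglyMeasurable_fun_sum _ fun c _ => (hF c b).star.mul_const _)

theorem aecover_Ioi_inv_nat :
    AECover (volume.restrict (Ioi (0 : ℝ))) atTop fun n : ℕ => Ioi ((1 : ℝ) / (n + 1)) :=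
  aecover_Ioi_of_Ioi tendsto_one_div_add_atTop_nhds_zero_nat

/-- Integrability is known only away from `0`; nonnegativity lets the limit of the tail integrals
give the full integral, by monotone convergence along `t = 1/(n+1)`. -/
theorem setLIntegral_eq_ofReal_of_tendsto {Q : ℝ → ENNReal} {q : ℝ → ℝ} {L : ℝ}
    (hQ : ∀ ρ, 0 < ρ → Q ρ = ENNReal.ofReal (q ρ)) (hq0 : ∀ ρ, 0 < ρ → 0 ≤ q ρ)
    (hq : ∀ t, 0 < t → IntegrableOn q (Ioi t))
    (hL : Tendsto (fun t => ∫ ρ in Ioi t, q ρ) (𝓝[>] 0) (𝓝 L)) :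
    ∫⁻ ρ in Ioi 0, Q ρ = ENNReal.ofReal L := by
  have hpos : ∀ n : ℕ, (0 : ℝ) < 1 / (n + 1) := fun n => Nat.one_div_pos_of_nat
  have hsub : ∀ n : ℕ, Ioi ((1 : ℝ) / (n + 1)) ⊆ Ioi 0 := fun n => Ioi_subset_Ioi (hpos n).le
  rw [setLIntegral_congr_fun measurableSet_Ioi hQ]
  refine aecover_Ioi_inv_nat.lintegral_eq_of_tendsto _ ?_ ?_
  · refine (aecover_Ioi_inv_nat.aestronglyMeasurable fun n => ?_).aemeasurable.ennreal_ofReal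
    rw [Measure.restrict_restrict_of_subset (hsub n)]
    exact (hq _ (hpos n)).aestronglyMeasurable
  · have h₁ : Tendsto (fun n : ℕ => (1 : ℝ) / (n + 1)) atTop (𝓝[>] 0) :=
      tendsto_nhdsWithin_iff.2 ⟨tendsto_one_div_add_atTop_nhds_zero_nat, .of_forall hpos⟩
    refine ((ENNReal.continuous_ofReal.tendsto L).comp (hL.comp h₁)).congr fun n => ?_
    rw [Measure.restrict_restrict_of_subset (hsub n), Function.comp_apply, Function.comp_apply]
    refine ofReal_integral_eq_lintegral_ofReal (hq _ (hpos n)) ?_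
    exact (ae_restrict_mem measurableSet_Ioi).mono fun ρ hρ => hq0 ρ (hsub n hρ)

/-- The Fourier coefficients of the family `S` resolve the identity on `H`-invariant matrices. -/
structure ResolvesIdentity : Prop where
  integrable : ∀ q ∈ Gplus, ∀ A : Matrix (Fin q.rep.dim) (Fin q.rep.dim) ℂ, ∀ t : ℝ, 0 < t →
    IntegrableOn (fun ρ => (α ρ : ℂ) * (((fourierCoeff μ (S ρ) q.rep)ᴴ * A)ᴴ *
      ((fourierCoeff μ (S ρ) q.rep)ᴴ * A)).trace) (Ioi t)
  tendsto : ∀ q ∈ Gplus, ∀ A : Matrix (Fin q.rep.dim) (Fin q.rep.dim) ℂ,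
    (∀ h ∈ H, q.rep.mat h * A = A) →
    Tendsto (fun t => ∫ ρ in Ioi t, (α ρ : ℂ) * (((fourierCoeff μ (S ρ) q.rep)ᴴ * A)ᴴ *
      ((fourierCoeff μ (S ρ) q.rep)ᴴ * A)).trace) (𝓝[>] 0) (𝓝 (Aᴴ * A).trace)

/-- Plancherel in `g` at fixed `ρ`, then the resolution of the identity in `ρ`, one representation
at a time. The lower integral makes square integrability part of the conclusion. -/
theorem lintegral_convStar_sq [IsProbabilityMeasure μ] [μ.IsMulLeftInvariant]
    (hα : AEMeasurable α (volume.restrict (Ioi 0))) (hα0 : ∀ ρ : ℝ, 0 < ρ → 0 ≤ α ρ)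
    (hS : AEStronglyMeasurable S (scaleMeasure α)) (hres : ResolvesIdentity μ H Gplus α S)
    {f : Lp ℂ 2 μ} (hf : f ∈ invariantSpan μ H Gplus) :
    AEStronglyMeasurable (fun z : ℝ × G => convStar μ f (S z.1) z.2) ((scaleMeasure α).prod μ) ∧
    ∫⁻ z : ℝ × G, ‖convStar μ f (S z.1) z.2‖ₑ ^ 2 ∂((scaleMeasure α).prod μ) =
      ENNReal.ofReal (‖f‖ ^ 2) := by
  obtain ⟨s, A, hA, hfA⟩ := exists_sum_of_mem_invariantSpan μ H Gplus hf
  set π : Gplus → UnitaryIrrep G := fun q => q.1.rep with hπ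
  have hne : ∀ i j, i ≠ j → ¬ (π i).Equivalent (π j) := fun i j hij h =>
    hij (Subtype.ext (UnitaryDual.eq_of_rep_equivalent h))
  set B : ℝ → ∀ q : Gplus, Matrix (Fin (π q).dim) (Fin (π q).dim) ℂ :=
    fun ρ q => (fourierCoeff μ (S ρ) (π q))ᴴ * A q with hB
  have hconv : ∀ ρ g, convStar μ f (S ρ) g = ∑ q ∈ s, ((π q).mat g * B ρ q).trace :=
    fun ρ g => convStar_sum μ s π A hfA (S ρ) g
  have hmeas : AEStronglyMeasurable (fun z : ℝ × G => convStar μ f (S z.1) z.2)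
      ((scaleMeasure α).prod μ) := by
    simp only [hconv]
    exact aestronglyMeasurable_sum_trace μ S s π A hS
  refine ⟨hmeas, ?_⟩
  have hmeas2 : AEMeasurable (fun z : ℝ × G => ‖convStar μ f (S z.1) z.2‖ₑ ^ 2)
      ((scaleMeasure α).prod μ) := hmeas.enorm.pow_const 2
  have hnormf : ((‖f‖ ^ 2 : ℝ) : ℂ) =
      ∑ q ∈ s, ((π q).dim : ℂ)⁻¹ * ((A q)ᴴ * A q).trace := by
    rw [← integral_norm_sq_sum_trace μ s π hne A, norm_sq_eq_integral_norm_sq]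
    congr 1
    exact integral_congr_ae (hfA.mono fun g hg => by simp only [hg]; rfl)
  -- The energy at scale `ρ`, including the weight.
  set q : ℝ → ℝ := fun ρ => α ρ * ∫ g, ‖convStar μ f (S ρ) g‖ ^ 2 ∂μ with hq
  have hqc : ∀ ρ, (q ρ : ℂ) =
      ∑ i ∈ s, ((π i).dim : ℂ)⁻¹ * ((α ρ : ℂ) * ((B ρ i)ᴴ * B ρ i).trace) := fun ρ => by
    rw [hq, Complex.ofReal_mul]
    simp only [hconv]
    rw [integral_norm_sq_sum_trace μ s π hne (B ρ), Finset.mul_sum]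
    exact Finset.sum_congr rfl fun i _ => by ring
  have hint : ∀ t, 0 < t → ∀ i ∈ s, IntegrableOn
      (fun ρ => ((π i).dim : ℂ)⁻¹ * ((α ρ : ℂ) * ((B ρ i)ᴴ * B ρ i).trace)) (Ioi t) :=
    fun t ht i _ => (hres.integrable i.1 i.2 (A i) t ht).const_mul _
  have hqint : ∀ t, 0 < t → IntegrableOn (fun ρ => (q ρ : ℂ)) (Ioi t) := fun t ht => by
    simp only [hqc]
    exact integrable_finsetSum _ (hint t ht)
  rw [lintegral_prod _ hmeas2, scaleMeasure, lintegral_withDensity_eq_lintegral_mul₀'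
    hα.ennreal_ofReal hmeas2.lintegral_prod_right']
  refine setLIntegral_eq_ofReal_of_tendsto (q := q) (fun ρ hρ => ?_) (fun ρ hρ => ?_)
    (fun t ht => ?_) ?_
  · have hcont : Continuous fun g => convStar μ f (S ρ) g := by
      simp only [hconv]; fun_prop
    have hcont2 : Continuous fun g => ‖convStar μ f (S ρ) g‖ ^ 2 := by fun_prop
    rw [Pi.mul_apply, hq, ENNReal.ofReal_mul (hα0 ρ hρ),
      ofReal_integral_eq_lintegral_ofReal (hcont2.integrable_of_hasCompactSupport
        (HasCompactSupport.of_compactSpace _)) (.of_forall fun g => sq_nonneg _)]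
    congr 2; funext g
    rw [ENNReal.ofReal_pow (norm_nonneg _), ofReal_norm]
  · exact mul_nonneg (hα0 ρ hρ) (integral_nonneg fun g => by positivity)
  · have := (hqint t ht).re
    simp only [RCLike.re_to_complex, Complex.ofReal_re] at this
    exact this
  · have h₁ : Tendsto (fun t => ((∫ ρ in Ioi t, q ρ : ℝ) : ℂ)) (𝓝[>] 0) (𝓝 ((‖f‖ ^ 2 : ℝ) : ℂ)) := by
      rw [hnormf]
      refine (tendsto_finsetSum _ fun i _ => (hres.tendsto i.1 i.2 (A i) (hA i)).const_mul
        ((π i).dim : ℂ)⁻¹).congr' ?_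
      filter_upwards [self_mem_nhdsWithin] with t ht
      rw [← integral_complex_ofReal]
      simp only [hqc]
      rw [integral_finsetSum _ (hint t ht)]
      exact Finset.sum_congr rfl fun i _ => (integral_const_mul _ _).symm
    simpa only [Function.comp_def, Complex.ofReal_re] using (Complex.continuous_re.tendsto _).comp h₁

end Isometry

/-- A linear family of functions that is isometric into `L²` on a subspace, and pointwise
continuous, is isometric on the closure of the subspace. -/
theorem exists_linearIsometry_topologicalClosure {E Ω : Type*} [NormedAddCommGroup E]
    [NormedSpace ℂ E] [MeasurableSpace Ω] {ν : Measure Ω} (T : Ω → E →L[ℂ] ℂ)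
    (K : Submodule ℂ E)
    (hT : ∀ x ∈ K, AEStronglyMeasurable (fun z => T z x) ν ∧
      ∫⁻ z, ‖T z x‖ₑ ^ 2 ∂ν = ENNReal.ofReal (‖x‖ ^ 2)) :
    ∃ W : K.topologicalClosure →ₗᵢ[ℂ] Lp ℂ 2 ν, ∀ x, W x =ᵐ[ν] fun z => T z x := by
  have h₁ : ∀ x ∈ K, ∃ F : Lp ℂ 2 ν, F =ᵐ[ν] (fun z => T z x) ∧ ‖F‖ = ‖x‖ := fun x hx => by
    obtain ⟨hm, hl⟩ := hT x hx
    have he : eLpNorm (fun z => T z x) 2 ν = ENNReal.ofReal ‖x‖ := by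
      have h := eLpNorm_nnreal_pow_eq_lintegral (f := fun z => T z x) (μ := ν) (p := 2) two_ne_zero
      have h2 : ((2 : NNReal) : ℝ) = (2 : ℕ) := by norm_num
      rw [h2, ENNReal.rpow_natCast] at h
      simp only [ENNReal.rpow_natCast] at h
      rw [hl, ENNReal.ofReal_pow (norm_nonneg x)] at h
      exact (ENNReal.pow_right_strictMono two_ne_zero).injective h
    have hmem : MemLp (fun z => T z x) 2 ν := ⟨hm, he ▸ ENNReal.ofReal_lt_top⟩
    refine ⟨hmem.toLp _, hmem.coeFn_toLp, ?_⟩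
    rw [Lp.norm_toLp, he, ENNReal.toReal_ofReal (norm_nonneg x)]
  have h₂ : ∀ x : K.topologicalClosure, ∃ F : Lp ℂ 2 ν, F =ᵐ[ν] (fun z => T z x) ∧ ‖F‖ = ‖x‖ := by
    rintro ⟨x, hx⟩
    obtain ⟨u, huK, hux⟩ := mem_closure_iff_seq_limit.1 hx
    choose F hF hFn using fun n => h₁ (u n) (huK n)
    -- The norm identity applied to the differences `u m - u n`, which lie in `K`.
    have hdist : ∀ m n, dist (F m) (F n) = dist (u m) (u n) := fun m n => by
      obtain ⟨D, hD, hDn⟩ := h₁ _ (K.sub_mem (huK m) (huK n))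
      have : F m - F n = D := by
        refine Lp.ext ?_
        filter_upwards [Lp.coeFn_sub (F m) (F n), hF m, hF n, hD] with z h₁ h₂ h₃ h₄
        rw [h₁, Pi.sub_apply, h₂, h₃, h₄, map_sub]
      rw [dist_eq_norm, dist_eq_norm, this, hDn]
    have hc : CauchySeq F := by
      have := hux.cauchySeq
      rw [Metric.cauchySeq_iff] at this ⊢
      simpa only [hdist] using this
    obtain ⟨Φ, hΦ⟩ := cauchySeq_tendsto_of_complete hc
    refine ⟨Φ, ?_, ?_⟩
    · obtain ⟨ns, hns, hae⟩ := (tendstoInMeasure_of_tendsto_Lp hΦ).exists_seq_tendsto_ae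
      filter_upwards [hae, ae_all_iff.2 hF] with z hz hFz
      refine tendsto_nhds_unique hz ?_
      simp only [hFz]
      exact (((T z).continuous.tendsto x).comp hux).comp hns.tendsto_atTop
    · refine tendsto_nhds_unique hΦ.norm ?_
      simp only [hFn]
      exact hux.norm
  choose F hF hFn using h₂
  refine ⟨⟨⟨⟨F, fun x y => Lp.ext ?_⟩, fun c x => Lp.ext ?_⟩, hFn⟩, hF⟩
  · filter_upwards [Lp.coeFn_add (F x) (F y), hF x, hF y, hF (x + y)] with z h₁ h₂ h₃ h₄
    rw [h₁, Pi.add_apply, h₂, h₃, h₄, Submodule.coe_add, map_add]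
  · filter_upwards [Lp.coeFn_smul c (F x), hF x, hF (c • x)] with z h₁ h₂ h₃
    rw [RingHom.id_apply, h₁, Pi.smul_apply, h₂, h₃, Submodule.coe_smul, map_smul]

/-! ### Admissibility as a resolution of the identity. -/

section Transform

variable {G : Type*} [Group G] [TopologicalSpace G] [IsTopologicalGroup G] [CompactSpace G]
  [SecondCountableTopology G] [MeasurableSpace G] [BorelSpace G] (μ : Measure G)
  {X : Type*} [TopologicalSpace X] [MeasurableSpace X] [BorelSpace X]
  [MulAction G X] [ContinuousSMul G X] [MulAction.IsPretransitive G X] (x₀ : X)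

/-- The functional `f ↦ (f * s^*)(g)` on `L²(G)`. -/
noncomputable def convStarCLM [μ.IsMulLeftInvariant] (s : Lp ℂ 2 μ) (g : G) : Lp ℂ 2 μ →L[ℂ] ℂ where
  toFun f := convStar μ f s g
  map_add' f₁ f₂ := convStar_add μ (Lp.memLp s) f₁ f₂ g
  map_smul' c f := convStar_smul μ s c f g
  cont := continuous_convStar μ (Lp.memLp s) g

theorem resolvesIdentity_of_isDiffusiveWaveletFamily [IsFiniteMeasure μ] [μ.IsMulLeftInvariant]
    [μ.IsMulRightInvariant] (μH : Measure (MulAction.stabilizer G x₀)) [IsProbabilityMeasure μH]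
    [μH.IsMulLeftInvariant] (Gplus : Set (UnitaryDual G)) (p : ℝ → Lp ℂ 1 μ)
    (hp : IsDiffusiveApproximateIdentity μ Gplus p) (α : ℝ → ℝ)
    (ψ : ℝ → Lp ℂ 2 (orbitMeasure μ x₀)) (hψ : IsDiffusiveWaveletFamily μ x₀ μH Gplus p α ψ) :
    ResolvesIdentity μ (MulAction.stabilizer G x₀) Gplus α (fun ρ => liftL2 μ x₀ (ψ ρ)) := by
  -- Cyclicity of the trace isolates `ŝ ŝ^*`, the coefficient of the zonal product, against the
  -- fixed matrix `A Aᴴ`.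
  have key : ∀ (π : UnitaryIrrep G) (A : Matrix (Fin π.dim) (Fin π.dim) ℂ) (ρ : ℝ),
      (α ρ : ℂ) * (((fourierCoeff μ (liftL2 μ x₀ (ψ ρ)) π)ᴴ * A)ᴴ *
        ((fourierCoeff μ (liftL2 μ x₀ (ψ ρ)) π)ᴴ * A)).trace =
      (A * Aᴴ * Matrix.of fun i j =>
        fourierCoeffX μ x₀ (zonalProd μ x₀ (ψ ρ) (ψ ρ)) π i j * (α ρ : ℂ)).trace := by
    intro π A ρ
    have h : (Matrix.of fun i j => fourierCoeffX μ x₀ (zonalProd μ x₀ (ψ ρ) (ψ ρ)) π i j *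
        (α ρ : ℂ)) = (α ρ : ℂ) • fourierCoeffX μ x₀ (zonalProd μ x₀ (ψ ρ) (ψ ρ)) π := by
      ext i j; simp [mul_comm]
    rw [h, fourierCoeffX_zonalProd, Matrix.mul_smul, Matrix.trace_smul, smul_eq_mul,
      Matrix.conjTranspose_mul, Matrix.conjTranspose_conjTranspose, Matrix.mul_assoc A,
      Matrix.trace_mul_comm A]
    simp only [Matrix.mul_assoc]
  have hint : ∀ (π : UnitaryIrrep G) (t : ℝ), 0 < t → ∀ i j, Integrable (fun ρ =>
      (Matrix.of fun i j => fourierCoeffX μ x₀ (zonalProd μ x₀ (ψ ρ) (ψ ρ)) π i j *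
        (α ρ : ℂ)) i j) (volume.restrict (Ioi t)) := fun π t ht i j => hψ.integrable t ht π i j
  refine ⟨fun q _ A t ht => ?_, fun q hq A hA => ?_⟩
  · simp only [key, trace_mul_eq_sum (A * Aᴴ)]
    exact integrable_finsetSum _ fun i _ => integrable_finsetSum _ fun j _ =>
      (hint q.rep t ht j i).const_mul _
  · simp only [key]
    have hM : ∀ h ∈ MulAction.stabilizer G x₀,
        q.rep.mat h * (A * Aᴴ) = A * Aᴴ ∧ A * Aᴴ * q.rep.mat h = A * Aᴴ := fun h hh => by
      refine ⟨by rw [← Matrix.mul_assoc, hA h hh], ?_⟩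
      -- Right invariance of `A Aᴴ` is the adjoint of left invariance of `A` under `h⁻¹`.
      have := congrArg Matrix.conjTranspose (hA _ (inv_mem hh))
      rw [Matrix.conjTranspose_mul, UnitaryIrrep.mat_inv, Matrix.conjTranspose_conjTranspose] at this
      rw [Matrix.mul_assoc, this]
    have h₁ : Tendsto (fun t => (A * Aᴴ * fourierCoeff μ (p t) q.rep).trace) (𝓝[>] 0)
        (𝓝 (Aᴴ * A).trace) := by
      have hc : Continuous fun B : Matrix (Fin q.rep.dim) (Fin q.rep.dim) ℂ =>
          (A * Aᴴ * B).trace := by fun_prop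
      have := (hc.tendsto 1).comp (hp.tendsto_zero q.rep)
      rwa [Matrix.mul_one, Matrix.trace_mul_comm] at this
    refine h₁.congr' ?_
    filter_upwards [self_mem_nhdsWithin] with t ht
    rw [← trace_mul_integral _ _ (hint q.rep t ht),
      ← trace_mul_fourierCoeffX_zonalAverage μ x₀ μH (L1.integrable_coeFn (p t)) q.rep _ hM]
    congr 2
    ext i j
    exact hψ.admissible t ht q.rep (by rwa [UnitaryDual.cls_rep]) i j

end Transform

end DiffusiveWavelet

open DiffusiveWavelet
theorem mainTheorem3
    {E : Type*} [NormedAddCommGroup E] [NormedSpace ℝ E] [FiniteDimensional ℝ E]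
    {G : Type*} [TopologicalSpace G] [T2Space G] [CompactSpace G] [ChartedSpace E G] [Group G]
    [LieGroup (modelWithCornersSelf ℝ E) ∞ G] [MeasurableSpace G] [BorelSpace G]
    {X : Type*} [TopologicalSpace X] [T2Space X] [MeasurableSpace X] [BorelSpace X]
    [MulAction G X] [ContinuousSMul G X] [MulAction.IsPretransitive G X]
    (μ : Measure G) [μ.IsHaarMeasure] [IsProbabilityMeasure μ]
    (x₀ : X)
    (μH : Measure (MulAction.stabilizer G x₀)) [μH.IsHaarMeasure] [IsProbabilityMeasure μH]
    (Gplus : Set (UnitaryDual G))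
    (p : ℝ → Lp ℂ 1 μ) (hp : IsDiffusiveApproximateIdentity μ Gplus p)
    (α : ℝ → ℝ) (hα : AEMeasurable α (volume.restrict (Ioi 0))) (hα0 : ∀ ρ : ℝ, 0 < ρ → 0 ≤ α ρ)
    (ψ : ℝ → Lp ℂ 2 (orbitMeasure μ x₀))
    (hψ : IsDiffusiveWaveletFamily μ x₀ μH Gplus p α ψ) :
    ∃ (R : Submodule ℂ (Lp ℂ 2 ((scaleMeasure α).prod μ))) (W : L2Zero μ x₀ Gplus ≃ₗᵢ[ℂ] R),
      IsClosed (R : Set (Lp ℂ 2 ((scaleMeasure α).prod μ))) ∧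
      ∀ φ : L2Zero μ x₀ Gplus,
        ((W φ : Lp ℂ 2 ((scaleMeasure α).prod μ)) : ℝ × G → ℂ)
          =ᵐ[(scaleMeasure α).prod μ]
            waveletTransform (orbitMeasure μ x₀) ψ (φ : Lp ℂ 2 (orbitMeasure μ x₀)) := by
  have : IsTopologicalGroup G := topologicalGroup_of_lieGroup (modelWithCornersSelf ℝ E) ∞
  have : ProperSpace E := FiniteDimensional.proper_real E
  -- Second countability makes the Borel structure of `G × G` the product one, as Fubini arguments
  -- with continuous functions require.
  have : SecondCountableTopology G := ChartedSpace.secondCountable_of_sigmaCompact E G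
  have : μ.IsMulRightInvariant := isMulRightInvariant_of_isProbabilityMeasure μ
  set S : ℝ → Lp ℂ 2 μ := fun ρ => liftL2 μ x₀ (ψ ρ)
  have hSm : AEStronglyMeasurable S (scaleMeasure α) :=
    (liftL2 μ x₀).continuous.comp_aestronglyMeasurable hψ.measurable
  have hres : ResolvesIdentity μ (MulAction.stabilizer G x₀) Gplus α S :=
    resolvesIdentity_of_isDiffusiveWaveletFamily μ x₀ μH Gplus p hp α ψ hψ
  obtain ⟨W, hW⟩ := exists_linearIsometry_topologicalClosure
    (ν := (scaleMeasure α).prod μ) (fun z : ℝ × G => convStarCLM μ (S z.1) z.2)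
    (invariantSpan μ (MulAction.stabilizer G x₀) Gplus) fun f hf =>
      lintegral_convStar_sq μ _ Gplus α S hα hα0 hSm hres hf
  have hmem : ∀ φ : L2Zero μ x₀ Gplus,
      liftL2 μ x₀ φ ∈ (invariantSpan μ (MulAction.stabilizer G x₀) Gplus).topologicalClosure := fun φ =>
    mem_closure_invariantSpan μ _ Gplus φ.2 fun π h hh =>
      fourierCoeff_liftL2_invariant μ x₀ φ π hh
  let V : L2Zero μ x₀ Gplus →ₗᵢ[ℂ] Lp ℂ 2 ((scaleMeasure α).prod μ) :=
    W.comp ⟨((liftL2 μ x₀).toLinearMap.comp (L2Zero μ x₀ Gplus).subtype).codRestrict _ hmem,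
      fun φ => (liftL2 μ x₀).norm_map φ⟩
  -- The preimage of a closed subspace under the lift; the resulting completeness of the domain
  -- makes the range of `V` closed.
  have hclosed : IsClosed (L2Zero μ x₀ Gplus : Set (Lp ℂ 2 (orbitMeasure μ x₀))) :=
    (Submodule.isClosed_topologicalClosure _).preimage (liftL2 μ x₀).continuous
  have : CompleteSpace (L2Zero μ x₀ Gplus) := hclosed.completeSpace_coe
  refine ⟨LinearMap.range V.toLinearMap, V.equivRange, ?_, fun φ => ?_⟩
  · exact V.isometry.isClosedEmbedding.isClosed_range
  · refine (hW ⟨liftL2 μ x₀ φ, hmem φ⟩).trans (.of_forall fun z => ?_)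
    exact (waveletTransform_eq_convStar μ x₀ ψ φ z).symm
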